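/- Let $(\Omega,\Pr)$ be a probability space and let $Z_1,\dots,Z_n$ ($n\ge 1$) be i.i.d. random variables on it with law $P$; write $Z$ for a generic observation with law $P$, let the covariates $X$ be a measurable function of $Z$, and write $Ph(Z)=\mathbb E[h(Z)]$ and $P_nh(Z)=\frac1n\sum_{i=1}^n h(Z_i)$. Let $f_1,\dots,f_M$ ($M\ge1$) be fixed real-valued candidate functions of $X$, and let $\Theta=\{\theta\in\mathbb R_{\ge0}^M:\sum_j\theta_j=1\}$, $f_\theta=\sum_j\theta_jf_j$, $\|f_\theta-f_{\theta'}\|^2=P(f_\theta(X)-f_{\theta'}(X))^2$; $e_j$ denotes the $j$-th unit vector. Let $g_0$ be the true nuisance and let $\hat g$ be a fixed nuisance estimate (computed from data independent of $Z_1,\dots,Z_n$, on which we condition). For a nuisance $g$ let $\hat Y(g)$ be a real-valued function of $Z$; assume $\mathbb E[\hat Y(g_0)^2]<\infty$. Consider the square loss, the modified loss and the risk $$\ell_{\theta,g}(Z)=(\hat Y(g)-f_\theta(X))^2,\qquad \tilde\ell_{\theta,g}(Z)=(1-\nu)\,\ell_{\theta,g}(Z)+\nu\sum_{j=1}^M\theta_j\,\ell_{e_j,g}(Z),\qquad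 R(\theta,g)=P\ell_{\theta,g}(Z).$$ Let $\pi_1,\dots,\pi_M>0$ with $\sum_j\pi_j=1$ be prior weights, and let $$Q(\theta)=P_n\tilde\ell_{\theta,\hat g}(Z)+\frac{\beta}{n}\sum_{j=1}^M\theta_j\log(1/\pi_j)$$ be the Q-aggregation objective. The greedy algorithm GMA-$0_+$ starts from $\theta^{(0)}=0$ and, for $m=1,2,\dots$, with $a_m=\frac{2}{m+1}$, chooses $$J^{(m)}\in\arg\min_{j}Q\big((1-a_m)\theta^{(m-1)}+a_me_j\big),\qquad \theta^{(m)}\in\arg\min\{Q(\theta):\theta\in\Theta,\ \theta_j=0\text{ for }j\notin\{J^{(1)},\dots,J^{(m)}\}\},$$ ties being broken arbitrarily. Let $\theta^k=\theta^{(k)}$ be its output after $k$ steps. **Theorem.** There is an absolute constant $C>0$ such that the following holds. Assume that for some $\gamma\in[0,1]$ and some number $\mathrm{Error}(\hat g)\ge0$, for all $\theta,\theta'\in\Theta$, $$P\big(\tilde\ell_{\theta,g_0}(Z)-\tilde\ell_{\theta',g_0}(Z)\big)-P\big(\tilde\ell_{\theta,\hat g}(Z)-\tilde\ell_{\theta',\hat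 g}(Z)\big)\le \mathrm{Error}(\hat g)\,\|f_\theta-f_{\theta'}\|^\gamma$$ (with the convention $0^0=1$), and that $|\hat Y(\hat g)|\le U$ and $|f_j(X)|\le U$ for all $j$, almost surely. Then for every $k\ge2$, $\nu\ge\frac12$, $0<\mu\le\frac1{60}(1-\nu)$, $$\beta\ge\max\Big\{\frac{64U^2(1-\nu)^2}{\mu},\ \frac{16\,\nu U^2(\nu+8\mu U)}{\mu}\Big\}$$ and $\delta\in(0,1)$, with probability at least $1-\delta$, $$R(\theta^k,g_0)\le\min_{1\le j\le M}\Big(R(e_j,g_0)+\frac{3\beta}{2n}\log(1/\pi_j)\Big)+C\,\frac{\log(1/\delta)\,\frac1\mu U^2}{n}+\Big(\frac1\mu\Big)^{\frac{\gamma}{2-\gamma}}\mathrm{Error}(\hat g)^{\frac{2}{2-\gamma}}.$$ -/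

import Mathlib

open MeasureTheory ProbabilityTheory

noncomputable section

namespace QAgg

/-- The ensemble `f_θ = ∑ j, θ_j f_j`. -/
def ensemble {M : ℕ} {𝒳 : Type*} (f : Fin M → 𝒳 → ℝ) (θ : Fin M → ℝ) (x : 𝒳) : ℝ :=
  ∑ j, θ j * f j x

/-- The square loss `ℓ_{θ,g}(Z) = (Ŷ(g)(Z) - f_θ(X))²`. All observed variables are collected in
`Z`, the covariates are `X = X(Z)`, and `Y g z` is the value of the proxy label `Ŷ(g)` at `Z = z`. -/
def loss {M : ℕ} {𝒵 𝒳 G : Type*} (Y : G → 𝒵 → ℝ) (X : 𝒵 → 𝒳) (f : Fin M → 𝒳 → ℝ)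
    (θ : Fin M → ℝ) (g : G) (z : 𝒵) : ℝ :=
  (Y g z - ensemble f θ (X z)) ^ 2

/-- The modified loss `ℓ̃_{θ,g} = (1-ν) ℓ_{θ,g} + ν ∑ j, θ_j ℓ_{e_j,g}`. -/
def modLoss {M : ℕ} {𝒵 𝒳 G : Type*} (ν : ℝ) (Y : G → 𝒵 → ℝ) (X : 𝒵 → 𝒳)
    (f : Fin M → 𝒳 → ℝ) (θ : Fin M → ℝ) (g : G) (z : 𝒵) : ℝ :=
  (1 - ν) * loss Y X f θ g z + ν * ∑ j, θ j * loss Y X f (Pi.single j 1) g z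

/-- The risk `R(θ,g) = P ℓ_{θ,g}(Z)`. -/
def risk {M : ℕ} {𝒵 𝒳 G : Type*} [MeasurableSpace 𝒵] (P : Measure 𝒵) (Y : G → 𝒵 → ℝ)
    (X : 𝒵 → 𝒳) (f : Fin M → 𝒳 → ℝ) (θ : Fin M → ℝ) (g : G) : ℝ :=
  ∫ z, loss Y X f θ g z ∂P

/-- The `L²` distance `‖f_θ - f_θ'‖ = (P (f_θ(X) - f_θ'(X))²)^{1/2}`. -/
def l2Dist {M : ℕ} {𝒵 𝒳 : Type*} [MeasurableSpace 𝒵] (P : Measure 𝒵)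
    (X : 𝒵 → 𝒳) (f : Fin M → 𝒳 → ℝ) (θ θ' : Fin M → ℝ) : ℝ :=
  Real.sqrt (∫ z, (ensemble f θ (X z) - ensemble f θ' (X z)) ^ 2 ∂P)

/-- The Q-aggregation objective
`Q(θ) = P_n ℓ̃_{θ,g}(Z) + (β/n) ∑ j, θ_j log (1/π_j)` on the sample `z`. -/
def qObjective {M n : ℕ} {𝒵 𝒳 G : Type*} (ν β : ℝ) (w : Fin M → ℝ) (Y : G → 𝒵 → ℝ)
    (X : 𝒵 → 𝒳) (f : Fin M → 𝒳 → ℝ) (g : G) (z : Fin n → 𝒵) (θ : Fin M → ℝ) : ℝ :=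
  (1 / (n : ℝ)) * ∑ i, modLoss ν Y X f θ g (z i)
    + (β / (n : ℝ)) * ∑ j, θ j * Real.log (1 / w j)

/-- The points of the simplex `Θ` whose coordinates vanish outside `S`. -/
def face {M : ℕ} (S : Finset (Fin M)) : Set (Fin M → ℝ) :=
  {θ | θ ∈ stdSimplex ℝ (Fin M) ∧ ∀ j, j ∉ S → θ j = 0}

/-- `GMARun Q k S θ`: some run of greedy model averaging GMA-0₊ on the objective `Q` has, after `k`
steps, selected the set of indices `S = {J⁽¹⁾, …, J⁽ᵏ⁾}` and has the current iterate `θ = θ⁽ᵏ⁾`.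
Ties in either of the two minimizations of a step may be broken in any way. Step `k + 1` uses the
step size `a_{k+1} = 2 / (k + 2)`. -/
inductive GMARun {M : ℕ} (Q : (Fin M → ℝ) → ℝ) : ℕ → Finset (Fin M) → (Fin M → ℝ) → Prop
  | init : GMARun Q 0 ∅ 0
  | step {k : ℕ} {S : Finset (Fin M)} {θ θ' : Fin M → ℝ} {J : Fin M}
      (prev : GMARun Q k S θ)
      (select : ∀ j : Fin M,
        Q ((1 - 2 / ((k : ℝ) + 2)) • θ + (2 / ((k : ℝ) + 2)) • Pi.single J 1)
          ≤ Q ((1 - 2 / ((k : ℝ) + 2)) • θ + (2 / ((k : ℝ) + 2)) • Pi.single j 1))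
      (mem : θ' ∈ face (insert J S))
      (optimal : ∀ η ∈ face (insert J S), Q θ' ≤ Q η) :
      GMARun Q (k + 1) (insert J S) θ'

/-- `θ` is a possible output of `k` steps of GMA-0₊ on `Q`. -/
def IsGMAOutput {M : ℕ} (Q : (Fin M → ℝ) → ℝ) (k : ℕ) (θ : Fin M → ℝ) : Prop :=
  ∃ S, GMARun Q k S θ

end QAgg

end

namespace QAgg

/-! Two facts carry the theorem.

Optimization: `Q` is exactly quadratic along segments, with curvature `1 - ν` times the squared
empirical distance. Comparing `θ` with a point between the first selected vertex and `e_j`, and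
using its minimality on a face containing that first vertex, shows that two greedy steps already
beat every vertex by `(1 - ν)/12` times the squared empirical distance
(`IsGMAOutput.qObjective_add_le`).

Concentration: for a fixed vertex `j`, the excess modified loss plus `5μ (f_θ - f_j)²` is a
quadratic form in `θ`, the average under `θ ⊗ θ` of a kernel free of `θ` (`modLoss_sub_eq`).
Uniformity over the data-dependent `θ` thus reduces to a Bernstein bound for the `M²` pairs `(i,
l)`, at levels `w i * w l * δ`. Averaging the bounds turns the log weights into twice the prior
penalty, which `β` absorbs, and the variances into `(9/2) μ ∑ θ_i ‖f_i - f_j‖²`. The latter is paid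
for by the quadratic gain and by the `ν`-weighted dispersion of the models separating modified risk
from risk (`risk_sub_eq`). Young's inequality absorbs the nuisance error, and
`risk_le_of_concentration` balances all terms. -/

/-! ### Quadratic structure of the objective along segments -/

lemma ensemble_single {M : ℕ} {𝒳 : Type*} (f : Fin M → 𝒳 → ℝ) (j : Fin M) (x : 𝒳) :
    ensemble f (Pi.single j 1) x = f j x := by
  simp [ensemble, Pi.single_apply]

lemma ensemble_combo {M : ℕ} {𝒳 : Type*} (f : Fin M → 𝒳 → ℝ) (θ η : Fin M → ℝ) (s t : ℝ) (x : 𝒳) :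
    ensemble f (s • θ + t • η) x = s * ensemble f θ x + t * ensemble f η x := by
  simp only [ensemble, Finset.mul_sum, ← Finset.sum_add_distrib]
  exact Finset.sum_congr rfl fun i _ => by simp; ring

/-- The `ν`-part is linear in `θ`, so only the square loss contributes curvature. -/
lemma modLoss_combo {M : ℕ} {𝒵 𝒳 G : Type*} (ν : ℝ) (Y : G → 𝒵 → ℝ) (X : 𝒵 → 𝒳)
    (f : Fin M → 𝒳 → ℝ) (θ η : Fin M → ℝ) (g : G) (z : 𝒵) (t : ℝ) :
    modLoss ν Y X f ((1 - t) • θ + t • η) g z =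
      (1 - t) * modLoss ν Y X f θ g z + t * modLoss ν Y X f η g z
        - (1 - ν) * (t * (1 - t)) * (ensemble f θ (X z) - ensemble f η (X z)) ^ 2 := by
  have h : ∑ j, ((1 - t) • θ + t • η) j * loss Y X f (Pi.single j 1) g z =
      (1 - t) * ∑ j, θ j * loss Y X f (Pi.single j 1) g z
        + t * ∑ j, η j * loss Y X f (Pi.single j 1) g z := by
    simp only [Finset.mul_sum, ← Finset.sum_add_distrib]
    exact Finset.sum_congr rfl fun i _ => by simp; ring
  unfold modLoss
  rw [h, loss, ensemble_combo]
  unfold loss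
  ring

lemma qObjective_combo {M n : ℕ} {𝒵 𝒳 G : Type*} (ν β : ℝ) (w : Fin M → ℝ) (Y : G → 𝒵 → ℝ)
    (X : 𝒵 → 𝒳) (f : Fin M → 𝒳 → ℝ) (g : G) (z : Fin n → 𝒵) (θ η : Fin M → ℝ) (t : ℝ) :
    qObjective ν β w Y X f g z ((1 - t) • θ + t • η) =
      (1 - t) * qObjective ν β w Y X f g z θ + t * qObjective ν β w Y X f g z η
        - (1 - ν) * (t * (1 - t)) * ((1 / (n : ℝ)) *
          ∑ i, (ensemble f θ (X (z i)) - ensemble f η (X (z i))) ^ 2) := by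
  have h : ∑ j, ((1 - t) • θ + t • η) j * Real.log (1 / w j) =
      (1 - t) * ∑ j, θ j * Real.log (1 / w j) + t * ∑ j, η j * Real.log (1 / w j) := by
    simp only [Finset.mul_sum, ← Finset.sum_add_distrib]
    exact Finset.sum_congr rfl fun i _ => by simp; ring
  unfold qObjective
  rw [h]
  simp only [modLoss_combo, Finset.sum_add_distrib, Finset.sum_sub_distrib, ← Finset.mul_sum]
  ring

/-! ### Faces of the simplex and the greedy run -/

lemma face_mono {M : ℕ} {S T : Finset (Fin M)} (h : S ⊆ T) : face S ⊆ face T :=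
  fun _ hθ => ⟨hθ.1, fun j hj => hθ.2 j fun hS => hj (h hS)⟩

lemma single_mem_face {M : ℕ} {S : Finset (Fin M)} {j : Fin M} (h : j ∈ S) :
    (Pi.single j 1 : Fin M → ℝ) ∈ face S :=
  ⟨single_mem_stdSimplex ℝ j, fun i hi => Pi.single_eq_of_ne (by rintro rfl; exact hi h) _⟩

lemma combo_mem_face {M : ℕ} {S : Finset (Fin M)} {θ η : Fin M → ℝ} (hθ : θ ∈ face S)
    (hη : η ∈ face S) {t : ℝ} (h0 : 0 ≤ t) (h1 : t ≤ 1) : (1 - t) • θ + t • η ∈ face S :=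
  ⟨convex_stdSimplex ℝ (Fin M) hθ.1 hη.1 (by linarith) h0 (by ring),
    fun j hj => by simp [hθ.2 j hj, hη.2 j hj]⟩

lemma eq_single_of_mem_face {M : ℕ} {j : Fin M} {θ : Fin M → ℝ} (h : θ ∈ face {j}) :
    θ = Pi.single j 1 := by
  have h0 : ∀ i, i ≠ j → θ i = 0 := fun i hi => h.2 i (by simpa using hi)
  have h1 : θ j = 1 := by
    rw [← h.1.2]
    exact (Finset.sum_eq_single j (fun i _ hi => h0 i hi) (by simp)).symm
  ext i
  by_cases hi : i = j
  · subst hi; simp [h1]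
  · simp [hi, h0 i hi]

/-- The facts about a nonempty run of GMA-0₊ used in its analysis. -/
lemma GMARun.exists_first {M : ℕ} {Q : (Fin M → ℝ) → ℝ} {k : ℕ} {S : Finset (Fin M)}
    {θ : Fin M → ℝ} (h : GMARun Q k S θ) (hk : 1 ≤ k) :
    ∃ J ∈ S, (∀ j, Q (Pi.single J 1) ≤ Q (Pi.single j 1)) ∧ θ ∈ face S ∧
      (∀ η ∈ face S, Q θ ≤ Q η) ∧ (k = 1 → θ = Pi.single J 1) ∧
      (2 ≤ k → ∀ j, Q θ ≤ Q ((1 - 2 / 3 : ℝ) • Pi.single J 1 + (2 / 3 : ℝ) • Pi.single j 1)) := by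
  induction h with
  | init => omega
  | @step k S θ θ' J prev select mem optimal ih =>
    rcases Nat.eq_zero_or_pos k with rfl | hk0
    · cases prev
      -- The first step size is `2 / (0 + 2) = 1`, so the start `0` drops out and the selection
      -- compares vertices.
      refine ⟨J, by simp, fun j => by simpa using select j, mem, optimal,
        fun _ => eq_single_of_mem_face (by simpa using mem), fun h => by omega⟩
    · obtain ⟨J₁, hJ₁, hmin, hθ, hopt, hone, htwo⟩ := ih hk0
      refine ⟨J₁, Finset.mem_insert_of_mem hJ₁, hmin, mem, optimal, fun h => by omega,
        fun _ j => ?_⟩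
      -- At the second step the iterate is the vertex `J₁` and the step size is `2/3`. Later the
      -- faces only grow, so `Q` cannot increase.
      rcases Nat.lt_or_ge k 2 with hk2 | hk2
      · obtain rfl : k = 1 := by omega
        have hs := select j
        rw [hone rfl] at hs
        norm_num at hs
        refine le_trans ?_ (le_trans hs (le_of_eq (by norm_num)))
        have := optimal _ (combo_mem_face (t := 2 / 3)
          (single_mem_face (Finset.mem_insert_of_mem hJ₁))
          (single_mem_face (Finset.mem_insert_self J S)) (by norm_num) (by norm_num))
        norm_num at this
        exact this
      · exact (optimal θ (face_mono (Finset.subset_insert J S) hθ)).trans (htwo hk2 j)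

lemma IsGMAOutput.mem_stdSimplex {M : ℕ} {Q : (Fin M → ℝ) → ℝ} {k : ℕ} {θ : Fin M → ℝ}
    (h : IsGMAOutput Q k θ) (hk : 1 ≤ k) : θ ∈ stdSimplex ℝ (Fin M) := by
  obtain ⟨S, hS⟩ := h
  obtain ⟨J, -, -, hθ, -⟩ := hS.exists_first hk
  exact hθ.1

/-- After two steps, GMA-0₊ improves on every vertex by a multiple of the squared empirical
distance to it. -/
lemma IsGMAOutput.qObjective_add_le {M n : ℕ} {𝒵 𝒳 G : Type*} {ν β : ℝ} (hν : ν ≤ 1)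
    {w : Fin M → ℝ} {Y : G → 𝒵 → ℝ} {X : 𝒵 → 𝒳} {f : Fin M → 𝒳 → ℝ} {g : G} {z : Fin n → 𝒵}
    {k : ℕ} (hk : 2 ≤ k) {θ : Fin M → ℝ} (h : IsGMAOutput (qObjective ν β w Y X f g z) k θ)
    (j : Fin M) :
    qObjective ν β w Y X f g z θ + (1 - ν) / 12 * ((1 / (n : ℝ)) *
        ∑ i, (ensemble f θ (X (z i)) - f j (X (z i))) ^ 2)
      ≤ qObjective ν β w Y X f g z (Pi.single j 1) := by
  obtain ⟨S, hS⟩ := h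
  obtain ⟨J, hJ, hmin, hθ, hopt, -, htwo⟩ := hS.exists_first (by omega)
  -- With `A`, `B` the squared empirical distances from `f_J` to `f_j` and to `f_θ`, `h1` and `h3`
  -- give a gain of `(2/9)(1-ν)A` over `e_j`, and `h2` and `h3` a gain of `(3/4)(1-ν)B`. Weights
  -- `2/3` and `1/3` produce exactly `(1-ν)/12` times the right side of `h4`.
  have h1 := htwo hk j
  have h2 := hopt _ (combo_mem_face (t := 1 / 4) hθ (single_mem_face hJ) (by norm_num)
    (by norm_num))
  rw [qObjective_combo] at h1 h2
  have h3 := hmin j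
  simp only [ensemble_single] at h1 h2
  have h4 : (1 / (n : ℝ)) * ∑ i, (ensemble f θ (X (z i)) - f j (X (z i))) ^ 2 ≤
      16 / 9 * ((1 / (n : ℝ)) * ∑ i, (f J (X (z i)) - f j (X (z i))) ^ 2)
      + 3 * ((1 / (n : ℝ)) * ∑ i, (ensemble f θ (X (z i)) - f J (X (z i))) ^ 2) := by
    have : ∑ i, (ensemble f θ (X (z i)) - f j (X (z i))) ^ 2 ≤
        16 / 9 * ∑ i, (f J (X (z i)) - f j (X (z i))) ^ 2
        + 3 * ∑ i, (ensemble f θ (X (z i)) - f J (X (z i))) ^ 2 := by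
      simp only [Finset.mul_sum, ← Finset.sum_add_distrib]
      refine Finset.sum_le_sum fun i _ => ?_
      nlinarith [sq_nonneg (7 * (f J (X (z i)) - f j (X (z i)))
        - 9 * (ensemble f θ (X (z i)) - f J (X (z i))))]
    have := mul_le_mul_of_nonneg_left this (by positivity : (0:ℝ) ≤ 1 / n)
    linarith
  have h5 := mul_le_mul_of_nonneg_left h4 (by linarith : 0 ≤ 1 - ν)
  linarith

/-! ### Concentration of bounded means, and Young's inequality -/

/-- Markov's inequality for the exponential moment of a bounded function of an i.i.d. sample. -/
lemma measure_deviation_le {Ω 𝒵 : Type*} [MeasurableSpace Ω] [MeasurableSpace 𝒵]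
    {Pr : Measure Ω} [IsProbabilityMeasure Pr] {P : Measure 𝒵} [IsProbabilityMeasure P] {n : ℕ}
    {Z : Fin n → Ω → 𝒵} (hZ : ∀ i, Measurable (Z i)) (hlaw : ∀ i, Measure.map (Z i) Pr = P)
    (hindep : iIndepFun Z Pr) {h : 𝒵 → ℝ} (hh : Measurable h) {B : ℝ}
    (hB : ∀ᵐ z ∂P, |h z| ≤ B) {lam : ℝ} (hlam : 0 ≤ lam) (hlamB : lam * B ≤ 1) {ε : ℝ}
    (hε : 0 < ε) :
    Pr {ω | n * lam ^ 2 * (∫ z, h z ^ 2 ∂P) + Real.log (1 / ε)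
        ≤ lam * (n * (∫ z, h z ∂P) - ∑ i, h (Z i ω))} ≤ ENNReal.ofReal ε := by
  have hint : Integrable h P := Integrable.of_bound hh.aestronglyMeasurable B hB
  have hint2 : Integrable (fun z => h z ^ 2) P := by
    refine Integrable.of_bound (hh.pow_const 2).aestronglyMeasurable (B ^ 2) ?_
    filter_upwards [hB] with z hz
    rw [Real.norm_eq_abs, abs_pow]
    exact pow_le_pow_left₀ (abs_nonneg _) hz 2
  have hbd : ∀ᵐ z ∂P, |-lam * h z| ≤ 1 := by
    filter_upwards [hB] with z hz
    rw [abs_mul, abs_neg, abs_of_nonneg hlam]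
    exact (mul_le_mul_of_nonneg_left hz hlam).trans hlamB
  have hintexp : Integrable (fun z => Real.exp (-lam * h z)) P := by
    refine Integrable.of_bound (by fun_prop) (Real.exp 1) ?_
    filter_upwards [hbd] with z hz
    rw [Real.norm_eq_abs, Real.abs_exp]
    exact Real.exp_le_exp.2 ((le_abs_self _).trans hz)
  have hone : ∫ z, Real.exp (-lam * h z) ∂P
      ≤ Real.exp (-lam * (∫ z, h z ∂P) + lam ^ 2 * ∫ z, h z ^ 2 ∂P) := by
    have h1 : ∫ z, Real.exp (-lam * h z) ∂P
        ≤ ∫ z, (1 + (-lam * h z) + lam ^ 2 * h z ^ 2) ∂P := by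
      refine integral_mono_ae hintexp
        (((integrable_const 1).add (hint.const_mul _)).add (hint2.const_mul _)) ?_
      filter_upwards [hbd] with z hz
      have := (abs_le.1 (Real.abs_exp_sub_one_sub_id_le hz)).2
      nlinarith
    have h2 : ∫ z, (1 + (-lam * h z) + lam ^ 2 * h z ^ 2) ∂P
        = 1 + -lam * (∫ z, h z ∂P) + lam ^ 2 * ∫ z, h z ^ 2 ∂P := by
      have e1 := integral_add ((integrable_const (1 : ℝ)).add (hint.const_mul (-lam)))
        (hint2.const_mul (lam ^ 2))
      have e2 := integral_add (integrable_const (μ := P) (1 : ℝ)) (hint.const_mul (-lam))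
      simp only [Pi.add_apply] at e1
      rw [e1, e2, integral_const_mul, integral_const_mul]
      simp
    rw [h2] at h1
    have := Real.add_one_le_exp (-lam * (∫ z, h z ∂P) + lam ^ 2 * ∫ z, h z ^ 2 ∂P)
    linarith
  have hmgf : ∀ i, mgf (fun ω => h (Z i ω)) Pr (-lam) = ∫ z, Real.exp (-lam * h z) ∂P := by
    intro i
    rw [mgf, ← hlaw i, integral_map (hZ i).aemeasurable (by fun_prop)]
  have hind : iIndepFun (fun i ω => h (Z i ω)) Pr := hindep.comp (fun _ => h) fun _ => hh
  have hsum : mgf (∑ i, fun ω => h (Z i ω)) Pr (-lam)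
      ≤ Real.exp (n * (-lam * (∫ z, h z ∂P) + lam ^ 2 * ∫ z, h z ^ 2 ∂P)) := by
    rw [hind.mgf_sum (fun i => hh.comp (hZ i)) Finset.univ]
    simp only [hmgf, Finset.prod_const, Finset.card_univ, Fintype.card_fin]
    rw [Real.exp_nat_mul]
    exact pow_le_pow_left₀ (integral_nonneg fun _ => (Real.exp_pos _).le) hone n
  have hintsum : Integrable (fun ω => Real.exp (-lam * (∑ i, fun ω => h (Z i ω)) ω)) Pr := by
    refine hind.integrable_exp_mul_sum (fun i => hh.comp (hZ i)) fun i _ => ?_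
    have : Integrable (fun z => Real.exp (-lam * h z)) (Measure.map (Z i) Pr) := by
      rwa [hlaw i]
    exact this.comp_measurable (hZ i)
  rw [← ofReal_measureReal]
  refine ENNReal.ofReal_le_ofReal ?_
  set a := lam * (n * (∫ z, h z ∂P)) - (n * lam ^ 2 * (∫ z, h z ^ 2 ∂P) + Real.log (1 / ε))
  have hsub : {ω | n * lam ^ 2 * (∫ z, h z ^ 2 ∂P) + Real.log (1 / ε)
        ≤ lam * (n * (∫ z, h z ∂P) - ∑ i, h (Z i ω))}
      = {ω | Real.exp (-a) ≤ Real.exp (-lam * (∑ i, fun ω => h (Z i ω)) ω)} := by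
    ext ω
    simp only [Set.mem_ofPred_eq, Real.exp_le_exp, Finset.sum_apply, a]
    constructor <;> intro <;> linarith
  rw [hsub]
  have hmk := mul_meas_ge_le_integral_of_nonneg
    (Filter.Eventually.of_forall fun ω => (Real.exp_pos _).le) hintsum (Real.exp (-a))
  change _ ≤ mgf (∑ i, fun ω => h (Z i ω)) Pr (-lam) at hmk
  have h2 := hmk.trans hsum
  have h3 : Real.exp (n * (-lam * (∫ z, h z ∂P) + lam ^ 2 * ∫ z, h z ^ 2 ∂P))
      = Real.exp (-a) * ε := by
    conv_rhs => rw [← Real.exp_log hε, ← Real.exp_add]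
    congr 1
    simp only [a, one_div, Real.log_inv]
    ring
  rw [h3] at h2
  exact le_of_mul_le_mul_left h2 (Real.exp_pos _)

/-- Young's inequality in the form that absorbs a power of a distance into its square. -/
lemma mul_rpow_le_sq_add {μ E x γ : ℝ} (hμ : 0 < μ) (hE : 0 ≤ E) (hx : 0 ≤ x) (h0 : 0 ≤ γ)
    (h1 : γ ≤ 1) :
    E * x ^ γ ≤ μ / 2 * x ^ 2 + (1 / μ) ^ (γ / (2 - γ)) * E ^ (2 / (2 - γ)) := by
  have hγ : 0 < 2 - γ := by linarith
  -- With these weights the powers of `μ` cancel in the geometric mean and `E` appears to the first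
  -- power.
  have key := Real.geom_mean_le_arith_mean2_weighted (w₁ := γ / 2) (w₂ := (2 - γ) / 2)
    (p₁ := μ * x ^ 2) (p₂ := (1 / μ) ^ (γ / (2 - γ)) * E ^ (2 / (2 - γ))) (by linarith)
    (by linarith) (by positivity) (by positivity) (by ring)
  have e1 : (μ * x ^ 2) ^ (γ / 2) = μ ^ (γ / 2) * x ^ γ := by
    rw [Real.mul_rpow hμ.le (by positivity), ← Real.rpow_natCast, ← Real.rpow_mul hx]
    congr 2
    push_cast
    ring
  have e2 : ((1 / μ) ^ (γ / (2 - γ)) * E ^ (2 / (2 - γ))) ^ ((2 - γ) / 2)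
      = (1 / μ) ^ (γ / 2) * E := by
    rw [Real.mul_rpow (by positivity) (by positivity), ← Real.rpow_mul (by positivity),
      ← Real.rpow_mul hE]
    have a1 : γ / (2 - γ) * ((2 - γ) / 2) = γ / 2 := by field_simp
    have a2 : 2 / (2 - γ) * ((2 - γ) / 2) = 1 := by field_simp
    rw [a1, a2, Real.rpow_one]
  have e3 : μ ^ (γ / 2) * (1 / μ) ^ (γ / 2) = 1 := by
    rw [← Real.mul_rpow hμ.le (by positivity), mul_one_div_cancel hμ.ne', Real.one_rpow]
  rw [e1, e2] at key
  have e4 : μ ^ (γ / 2) * x ^ γ * ((1 / μ) ^ (γ / 2) * E) = E * x ^ γ := by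
    linear_combination (E * x ^ γ) * e3
  rw [e4] at key
  have t1 : γ / 2 * (μ * x ^ 2) ≤ 1 / 2 * (μ * x ^ 2) :=
    mul_le_mul_of_nonneg_right (by linarith) (by positivity)
  have t2 : (2 - γ) / 2 * ((1 / μ) ^ (γ / (2 - γ)) * E ^ (2 / (2 - γ)))
      ≤ 1 * ((1 / μ) ^ (γ / (2 - γ)) * E ^ (2 / (2 - γ))) :=
    mul_le_mul_of_nonneg_right (by linarith) (by positivity)
  linarith

/-- One-sided deviation of an empirical mean, for functions bounded by `8U²` whose second moment is
at most `8U²V`. -/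
lemma measure_mean_deviation_le {Ω 𝒵 : Type*} [MeasurableSpace Ω] [MeasurableSpace 𝒵]
    {Pr : Measure Ω} [IsProbabilityMeasure Pr] {P : Measure 𝒵} [IsProbabilityMeasure P] {n : ℕ}
    (hn : 1 ≤ n) {Z : Fin n → Ω → 𝒵} (hZ : ∀ i, Measurable (Z i))
    (hlaw : ∀ i, Measure.map (Z i) Pr = P) (hindep : iIndepFun Z Pr) {h : 𝒵 → ℝ}
    (hh : Measurable h) {U μ V : ℝ} (hU : 0 ≤ U) (hμ : 0 < μ) (hμ1 : μ ≤ 4 / 9) (hV : 0 ≤ V)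
    (hB : ∀ᵐ z ∂P, |h z| ≤ 8 * U ^ 2) (hvar : ∫ z, h z ^ 2 ∂P ≤ 8 * U ^ 2 * V) {ε : ℝ}
    (hε : 0 < ε) :
    Pr {ω | 9 / 4 * μ * V + 32 * U ^ 2 / (9 * μ) / n * Real.log (1 / ε)
        < (∫ z, h z ∂P) - 1 / (n : ℝ) * ∑ i, h (Z i ω)} ≤ ENNReal.ofReal ε := by
  have hn0 : (0 : ℝ) < n := by exact_mod_cast hn
  -- For `U = 0` the tuning parameter below degenerates; the deviation is then almost surely zero,
  -- and the strict inequality makes the event null.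
  rcases hU.eq_or_lt with rfl | hU
  · have h0 : ∀ᵐ z ∂P, h z = 0 := by
      filter_upwards [hB] with z hz
      exact abs_nonpos_iff.1 (by simpa using hz)
    have h1 : ∫ z, h z ∂P = 0 := integral_eq_zero_of_ae h0
    have h2 : ∀ᵐ ω ∂Pr, ∀ i, h (Z i ω) = 0 := by
      refine ae_all_iff.2 fun i => ?_
      rw [← hlaw i] at h0
      exact ae_of_ae_map (hZ i).aemeasurable h0
    have h3 : Pr {ω | ¬ ∀ i, h (Z i ω) = 0} = 0 := h2
    refine le_trans (measure_mono fun ω hω => ?_) (h3.le.trans bot_le)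
    intro hall
    simp only [Set.mem_ofPred_eq, h1, hall] at hω
    have : 0 ≤ 9 / 4 * μ * V := by positivity
    norm_num at hω
    linarith
  · have key := measure_deviation_le hZ hlaw hindep hh hB (lam := 9 * μ / (32 * U ^ 2))
      (by positivity) (by field_simp; linarith) hε
    refine le_trans (measure_mono fun ω hω => ?_) key
    simp only [Set.mem_ofPred_eq] at hω ⊢
    set lam := 9 * μ / (32 * U ^ 2) with hl
    have hlam : 0 < lam := by positivity
    have e1 : 32 * U ^ 2 / (9 * μ) = 1 / lam := by rw [hl]; field_simp
    have e2 : lam * (8 * U ^ 2) = 9 / 4 * μ := by rw [hl]; field_simp; ring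
    rw [e1] at hω
    have h4 := mul_le_mul_of_nonneg_left hω.le (by positivity : 0 ≤ lam * n)
    have h5 : lam * n * (9 / 4 * μ * V + 1 / lam / n * Real.log (1 / ε))
        = n * lam ^ 2 * (8 * U ^ 2 * V) + Real.log (1 / ε) := by
      rw [← e2]; field_simp
    have h6 : lam * n * ((∫ z, h z ∂P) - 1 / (n : ℝ) * ∑ i, h (Z i ω))
        = lam * (n * (∫ z, h z ∂P) - ∑ i, h (Z i ω)) := by
      field_simp
    rw [h5, h6] at h4
    have h7 := mul_le_mul_of_nonneg_left hvar (by positivity : 0 ≤ n * lam ^ 2)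
    linarith

/-! ### The pair kernel -/

/-- The kernel of the quadratic form in `θ` that represents the excess modified loss over the
vertex `j`, for the label `y` and the model values `a`. -/
noncomputable def pairing {M : ℕ} (ν c y : ℝ) (a : Fin M → ℝ) (j i l : Fin M) : ℝ :=
  ((y - a i) ^ 2 + (y - a l) ^ 2) / 2 - (y - a j) ^ 2
    - (1 - ν) * ((a i - a j) ^ 2 + (a l - a j) ^ 2) / 2 + c * ((a i - a j) * (a l - a j))

/-- The kernel factors through the differences `a i - a j` and `a l - a j`; the cofactors are
combinations of values bounded by `U` with absolute coefficients `2 + (2 - ν - c) + ν + c = 4`.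
Keeping the differences is what makes the second moment small near the vertex `j`. -/
lemma abs_pairing_le {M : ℕ} {ν c y U : ℝ} {a : Fin M → ℝ} (hy : |y| ≤ U) (ha : ∀ i, |a i| ≤ U)
    (hν : 0 ≤ ν) (hc : 0 ≤ c) (hcν : c ≤ 2 - ν) (j i l : Fin M) :
    |pairing ν c y a j i l| ≤ 2 * U * (|a i - a j| + |a l - a j|) := by
  have hb : ∀ p q, |-2 * y + (2 - ν - c) * a j + ν * a p + c * a q| ≤ 4 * U := by
    intro p q
    obtain ⟨y1, y2⟩ := abs_le.1 hy
    obtain ⟨j1, j2⟩ := abs_le.1 (ha j)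
    obtain ⟨p1, p2⟩ := abs_le.1 (ha p)
    obtain ⟨q1, q2⟩ := abs_le.1 (ha q)
    have hd : 0 ≤ 2 - ν - c := by linarith
    have := mul_le_mul_of_nonneg_left j1 hd
    have := mul_le_mul_of_nonneg_left j2 hd
    have := mul_le_mul_of_nonneg_left p1 hν
    have := mul_le_mul_of_nonneg_left p2 hν
    have := mul_le_mul_of_nonneg_left q1 hc
    have := mul_le_mul_of_nonneg_left q2 hc
    rw [abs_le]
    constructor <;> linarith
  have e : pairing ν c y a j i l =
      1 / 2 * ((a i - a j) * (-2 * y + (2 - ν - c) * a j + ν * a i + c * a l))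
      + 1 / 2 * ((a l - a j) * (-2 * y + (2 - ν - c) * a j + ν * a l + c * a i)) := by
    unfold pairing; ring
  rw [e]
  refine (abs_add_le _ _).trans ?_
  rw [abs_mul, abs_mul, abs_mul, abs_mul, abs_of_pos (by norm_num : (0:ℝ) < 1 / 2)]
  have := mul_le_mul_of_nonneg_left (hb i l) (abs_nonneg (a i - a j))
  have := mul_le_mul_of_nonneg_left (hb l i) (abs_nonneg (a l - a j))
  linarith

lemma abs_pairing_le_sq {M : ℕ} {ν c y U : ℝ} {a : Fin M → ℝ} (hy : |y| ≤ U)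
    (ha : ∀ i, |a i| ≤ U) (hν : 0 ≤ ν) (hc : 0 ≤ c) (hcν : c ≤ 2 - ν) (j i l : Fin M) :
    |pairing ν c y a j i l| ≤ 8 * U ^ 2 := by
  refine (abs_pairing_le hy ha hν hc hcν j i l).trans ?_
  have hU : 0 ≤ U := (abs_nonneg _).trans hy
  have h1 : ∀ p, |a p - a j| ≤ 2 * U := fun p =>
    (abs_sub _ _).trans (by linarith [ha p, ha j])
  nlinarith [h1 i, h1 l]

lemma pairing_sq_le {M : ℕ} {ν c y U : ℝ} {a : Fin M → ℝ} (hy : |y| ≤ U)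
    (ha : ∀ i, |a i| ≤ U) (hν : 0 ≤ ν) (hc : 0 ≤ c) (hcν : c ≤ 2 - ν) (j i l : Fin M) :
    pairing ν c y a j i l ^ 2 ≤ 8 * U ^ 2 * ((a i - a j) ^ 2 + (a l - a j) ^ 2) := by
  have h := pow_le_pow_left₀ (abs_nonneg _) (abs_pairing_le hy ha hν hc hcν j i l) 2
  rw [sq_abs, mul_pow] at h
  refine h.trans ?_
  have : (|a i - a j| + |a l - a j|) ^ 2 ≤ 2 * ((a i - a j) ^ 2 + (a l - a j) ^ 2) := by
    rw [← sq_abs (a i - a j), ← sq_abs (a l - a j)]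
    nlinarith [sq_nonneg (|a i - a j| - |a l - a j|)]
  nlinarith [sq_nonneg U]

lemma sum_mul_sq_sub {M : ℕ} {θ : Fin M → ℝ} (hθ : ∑ i, θ i = 1) (a : Fin M → ℝ) (y : ℝ) :
    ∑ i, θ i * (y - a i) ^ 2 = y ^ 2 - 2 * y * (∑ i, θ i * a i) + ∑ i, θ i * a i ^ 2 := by
  have : ∀ i, θ i * (y - a i) ^ 2 = y ^ 2 * θ i - 2 * y * (θ i * a i) + θ i * a i ^ 2 :=
    fun i => by ring
  simp only [this, Finset.sum_add_distrib, Finset.sum_sub_distrib, ← Finset.mul_sum, hθ, mul_one]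

lemma sum_sum_add {M : ℕ} {θ : Fin M → ℝ} (hθ : ∑ i, θ i = 1) (u : Fin M → ℝ) :
    ∑ i, ∑ l, θ i * θ l * (u i + u l) = 2 * ∑ i, θ i * u i := by
  have h : ∀ i l, θ i * θ l * (u i + u l) = θ i * u i * θ l + θ i * (θ l * u l) :=
    fun i l => by ring
  simp only [h, Finset.sum_add_distrib, ← Finset.mul_sum, ← Finset.sum_mul, hθ]
  ring

lemma sum_sum_pairing {M : ℕ} {θ : Fin M → ℝ} (hθ : ∑ i, θ i = 1) (ν c y : ℝ) (a : Fin M → ℝ)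
    (j : Fin M) :
    ∑ i, ∑ l, θ i * θ l * pairing ν c y a j i l =
      (∑ i, θ i * (y - a i) ^ 2) - (y - a j) ^ 2 - (1 - ν) * (∑ i, θ i * (a i - a j) ^ 2)
        + c * ((∑ i, θ i * a i) - a j) ^ 2 := by
  have hd : ∑ i, θ i * (a i - a j) = (∑ i, θ i * a i) - a j := by
    simp only [mul_sub, Finset.sum_sub_distrib, ← Finset.sum_mul, hθ, one_mul]
  have h : ∀ i l, θ i * θ l * pairing ν c y a j i l =
      θ i * θ l * ((((y - a i) ^ 2 - (y - a j) ^ 2 - (1 - ν) * (a i - a j) ^ 2) / 2)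
        + (((y - a l) ^ 2 - (y - a j) ^ 2 - (1 - ν) * (a l - a j) ^ 2) / 2))
      + c * ((θ i * (a i - a j)) * (θ l * (a l - a j))) :=
    fun i l => by unfold pairing; ring
  simp only [h, Finset.sum_add_distrib, ← Finset.mul_sum, ← Finset.sum_mul, hd]
  rw [sum_sum_add hθ]
  have h2 : ∀ i, θ i * (((y - a i) ^ 2 - (y - a j) ^ 2 - (1 - ν) * (a i - a j) ^ 2) / 2)
      = (1 / 2) * (θ i * (y - a i) ^ 2) - (1 / 2) * (y - a j) ^ 2 * θ i
        - (1 - ν) / 2 * (θ i * (a i - a j) ^ 2) := fun i => by ring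
  simp only [h2, Finset.sum_sub_distrib, ← Finset.mul_sum, hθ]
  ring

lemma modLoss_single {M : ℕ} {𝒵 𝒳 G : Type*} (ν : ℝ) (Y : G → 𝒵 → ℝ) (X : 𝒵 → 𝒳)
    (f : Fin M → 𝒳 → ℝ) (j : Fin M) (g : G) (z : 𝒵) :
    modLoss ν Y X f (Pi.single j 1) g z = (Y g z - f j (X z)) ^ 2 := by
  simp [modLoss, loss, ensemble_single, Pi.single_apply]
  ring

/-- The gap between the averaged vertex losses and the loss of the ensemble is the variance of the
model values under `θ`. It does not depend on the label and may be centred at any vertex. -/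
lemma modLoss_eq {M : ℕ} {𝒵 𝒳 G : Type*} (ν : ℝ) (Y : G → 𝒵 → ℝ) (X : 𝒵 → 𝒳)
    (f : Fin M → 𝒳 → ℝ) {θ : Fin M → ℝ} (hθ : ∑ i, θ i = 1) (g : G) (z : 𝒵) (j : Fin M) :
    modLoss ν Y X f θ g z = loss Y X f θ g z
      + ν * ((∑ i, θ i * (f i (X z) - f j (X z)) ^ 2)
        - (ensemble f θ (X z) - f j (X z)) ^ 2) := by
  have h1 := sum_mul_sq_sub hθ (fun i => f i (X z)) (Y g z)
  have h2 := sum_mul_sq_sub hθ (fun i => f i (X z)) (f j (X z))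
  have h3 : ∀ i, (f i (X z) - f j (X z)) ^ 2 = (f j (X z) - f i (X z)) ^ 2 := fun i => by ring
  simp only [modLoss, loss, ensemble_single]
  simp only [h3, h2, h1, ensemble]
  ring

lemma modLoss_sub_eq {M : ℕ} {𝒵 𝒳 G : Type*} (ν b : ℝ) (Y : G → 𝒵 → ℝ) (X : 𝒵 → 𝒳)
    (f : Fin M → 𝒳 → ℝ) {θ : Fin M → ℝ} (hθ : ∑ i, θ i = 1) (g : G) (z : 𝒵) (j : Fin M) :
    modLoss ν Y X f θ g z - modLoss ν Y X f (Pi.single j 1) g z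
        + b * (ensemble f θ (X z) - f j (X z)) ^ 2
      = ∑ i, ∑ l, θ i * θ l * pairing ν (1 - ν + b) (Y g z) (fun i => f i (X z)) j i l := by
  have h1 := sum_mul_sq_sub hθ (fun i => f i (X z)) (Y g z)
  have h2 := sum_mul_sq_sub hθ (fun i => f i (X z)) (f j (X z))
  have h3 : ∀ i, (f i (X z) - f j (X z)) ^ 2 = (f j (X z) - f i (X z)) ^ 2 := fun i => by ring
  rw [sum_sum_pairing hθ, modLoss_single]
  simp only [modLoss, loss, ensemble_single]
  simp only [h3, h2, h1, ensemble]
  ring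

/-! ### Integrability and the excess risk -/

lemma memLp_ensemble {M : ℕ} {𝒵 𝒳 : Type*} [MeasurableSpace 𝒵] [MeasurableSpace 𝒳]
    {P : Measure 𝒵} {X : 𝒵 → 𝒳} {f : Fin M → 𝒳 → ℝ}
    (hf : ∀ j, MemLp (fun z => f j (X z)) 2 P) (θ : Fin M → ℝ) :
    MemLp (fun z => ensemble f θ (X z)) 2 P := by
  unfold ensemble
  exact memLp_finsetSum _ fun i _ => (hf i).const_mul _

lemma integrable_loss {M : ℕ} {𝒵 𝒳 G : Type*} [MeasurableSpace 𝒵] [MeasurableSpace 𝒳]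
    {P : Measure 𝒵} {X : 𝒵 → 𝒳} {f : Fin M → 𝒳 → ℝ} {Y : G → 𝒵 → ℝ} {g : G}
    (hf : ∀ j, MemLp (fun z => f j (X z)) 2 P) (hY : MemLp (Y g) 2 P) (θ : Fin M → ℝ) :
    Integrable (loss Y X f θ g) P :=
  (hY.sub (memLp_ensemble hf θ)).integrable_sq

lemma integrable_modLoss {M : ℕ} {𝒵 𝒳 G : Type*} [MeasurableSpace 𝒵] [MeasurableSpace 𝒳]
    {P : Measure 𝒵} {X : 𝒵 → 𝒳} {f : Fin M → 𝒳 → ℝ} {Y : G → 𝒵 → ℝ} {g : G} (ν : ℝ)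
    (hf : ∀ j, MemLp (fun z => f j (X z)) 2 P) (hY : MemLp (Y g) 2 P) (θ : Fin M → ℝ) :
    Integrable (modLoss ν Y X f θ g) P :=
  ((integrable_loss hf hY θ).const_mul _).add
    ((integrable_finsetSum _ fun _ _ => (integrable_loss hf hY _).const_mul _).const_mul _)

/-- The excess risk in terms of the modified loss. -/
lemma risk_sub_eq {M : ℕ} {𝒵 𝒳 G : Type*} [MeasurableSpace 𝒵] [MeasurableSpace 𝒳]
    {P : Measure 𝒵} {X : 𝒵 → 𝒳} {f : Fin M → 𝒳 → ℝ} {Y : G → 𝒵 → ℝ} {g : G} (ν : ℝ)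
    (hf : ∀ j, MemLp (fun z => f j (X z)) 2 P) (hY : MemLp (Y g) 2 P) {θ : Fin M → ℝ}
    (hθ : ∑ i, θ i = 1) (j : Fin M) :
    risk P Y X f θ g - risk P Y X f (Pi.single j 1) g =
      (∫ z, (modLoss ν Y X f θ g z - modLoss ν Y X f (Pi.single j 1) g z) ∂P)
      - ν * ((∑ i, θ i * ∫ z, (f i (X z) - f j (X z)) ^ 2 ∂P)
        - ∫ z, (ensemble f θ (X z) - f j (X z)) ^ 2 ∂P) := by
  have hd : ∀ i, Integrable (fun z => (f i (X z) - f j (X z)) ^ 2) P :=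
    fun i => ((hf i).sub (hf j)).integrable_sq
  have hdθ : Integrable (fun z => (ensemble f θ (X z) - f j (X z)) ^ 2) P :=
    ((memLp_ensemble hf θ).sub (hf j)).integrable_sq
  have hs : Integrable (fun z => ∑ i, θ i * (f i (X z) - f j (X z)) ^ 2) P :=
    integrable_finsetSum _ fun i _ => (hd i).const_mul _
  have e : ∀ z, modLoss ν Y X f θ g z - modLoss ν Y X f (Pi.single j 1) g z =
      (loss Y X f θ g z - loss Y X f (Pi.single j 1) g z)
      + ν * ((∑ i, θ i * (f i (X z) - f j (X z)) ^ 2)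
        - (ensemble f θ (X z) - f j (X z)) ^ 2) := by
    intro z
    rw [modLoss_eq ν Y X f hθ g z j, modLoss_single]
    simp only [loss, ensemble_single]
    ring
  have hl : Integrable
      (fun z => loss Y X f θ g z - loss Y X f (Pi.single j 1) g z) P :=
    (integrable_loss hf hY θ).sub (integrable_loss hf hY _)
  have hv : Integrable (fun z => ν * ((∑ i, θ i * (f i (X z) - f j (X z)) ^ 2)
      - (ensemble f θ (X z) - f j (X z)) ^ 2)) P := (hs.sub hdθ).const_mul ν
  simp only [e]
  rw [integral_add hl hv, integral_sub (integrable_loss hf hY θ) (integrable_loss hf hY _),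
    integral_const_mul, integral_sub hs hdθ,
    integral_finsetSum _ fun i _ => (hd i).const_mul (θ i)]
  simp only [integral_const_mul, risk]
  ring

lemma sum_mul_sq_sub_ge {M : ℕ} {𝒵 𝒳 : Type*} [MeasurableSpace 𝒵] [MeasurableSpace 𝒳]
    {P : Measure 𝒵} {X : 𝒵 → 𝒳} {f : Fin M → 𝒳 → ℝ}
    (hf : ∀ j, MemLp (fun z => f j (X z)) 2 P) {θ : Fin M → ℝ}
    (hθ : θ ∈ stdSimplex ℝ (Fin M)) (j : Fin M) :
    ∫ z, (ensemble f θ (X z) - f j (X z)) ^ 2 ∂P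
      ≤ ∑ i, θ i * ∫ z, (f i (X z) - f j (X z)) ^ 2 ∂P := by
  have hd : ∀ i, Integrable (fun z => (f i (X z) - f j (X z)) ^ 2) P :=
    fun i => ((hf i).sub (hf j)).integrable_sq
  simp only [← integral_const_mul]
  rw [← integral_finsetSum _ fun i _ => (hd i).const_mul (θ i)]
  refine integral_mono ((memLp_ensemble hf θ).sub (hf j)).integrable_sq
    (integrable_finsetSum _ fun i _ => (hd i).const_mul (θ i)) fun z => ?_
  have h1 : ∑ i, θ i * (f i (X z) - f j (X z)) = ensemble f θ (X z) - f j (X z) := by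
    simp only [mul_sub, Finset.sum_sub_distrib, ← Finset.sum_mul, hθ.2, one_mul, ensemble]
  have := (Even.convexOn_pow (n := 2) even_two).map_sum_le (t := Finset.univ) (w := θ)
    (p := fun i => f i (X z) - f j (X z)) (fun i _ => hθ.1 i) hθ.2 (fun i _ => Set.mem_univ _)
  simpa only [smul_eq_mul, h1] using this

/-! ### The deterministic oracle inequality -/

/-- The oracle inequality on the event where all pairs concentrate. -/
lemma risk_le_of_concentration {M n : ℕ} {𝒵 𝒳 G : Type*} [MeasurableSpace 𝒵]
    [MeasurableSpace 𝒳] {P : Measure 𝒵} {X : 𝒵 → 𝒳} {f : Fin M → 𝒳 → ℝ}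
    {Y : G → 𝒵 → ℝ} {g₀ g : G} (hf : ∀ j, MemLp (fun z => f j (X z)) 2 P)
    (hY₀ : MemLp (Y g₀) 2 P) (hY : MemLp (Y g) 2 P) {w : Fin M → ℝ} (hw : ∀ j, 0 < w j)
    (hw1 : ∀ j, w j ≤ 1) {ν μ β κ L E γ : ℝ} (hμ : 0 < μ) (hμν : μ ≤ 1 / 60 * (1 - ν))
    (hνμ : 9 / 2 * μ ≤ ν) (hκ : 2 * κ ≤ β) (hβ : 0 ≤ β) (hγ₀ : 0 ≤ γ) (hγ₁ : γ ≤ 1)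
    (hE : 0 ≤ E) {θ : Fin M → ℝ} (hθ : θ ∈ stdSimplex ℝ (Fin M)) (j : Fin M)
    (hErr : (∫ z, (modLoss ν Y X f θ g₀ z - modLoss ν Y X f (Pi.single j 1) g₀ z) ∂P)
        - (∫ z, (modLoss ν Y X f θ g z - modLoss ν Y X f (Pi.single j 1) g z) ∂P)
        ≤ E * l2Dist P X f θ (Pi.single j 1) ^ γ) {z : Fin n → 𝒵}
    (hQ : qObjective ν β w Y X f g z θ + (1 - ν) / 12 * ((1 / (n : ℝ)) *
        ∑ i, (ensemble f θ (X (z i)) - f j (X (z i))) ^ 2)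
      ≤ qObjective ν β w Y X f g z (Pi.single j 1))
    (hconc : ∀ i l,
      (∫ x, pairing ν (1 - ν + 5 * μ) (Y g x) (fun i => f i (X x)) j i l ∂P)
        - 1 / (n : ℝ) *
          ∑ m, pairing ν (1 - ν + 5 * μ) (Y g (z m)) (fun i => f i (X (z m))) j i l
      ≤ 9 / 4 * μ * ((∫ x, (f i (X x) - f j (X x)) ^ 2 ∂P)
          + ∫ x, (f l (X x) - f j (X x)) ^ 2 ∂P)
        + κ / n * (Real.log (1 / w i) + Real.log (1 / w l) + L)) :
    risk P Y X f θ g₀ ≤ risk P Y X f (Pi.single j 1) g₀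
      + 3 * β / (2 * (n : ℝ)) * Real.log (1 / w j) + κ / n * L
      + (1 / μ) ^ (γ / (2 - γ)) * E ^ (2 / (2 - γ)) := by
  set D : Fin M → ℝ := fun i => ∫ x, (f i (X x) - f j (X x)) ^ 2 ∂P with hD
  set Dθ : ℝ := ∫ z, (ensemble f θ (X z) - f j (X z)) ^ 2 ∂P with hDθ
  set p : Fin M → Fin M → 𝒵 → ℝ := fun i l x =>
    pairing ν (1 - ν + 5 * μ) (Y g x) (fun i => f i (X x)) j i l with hp
  have hlogs : ∀ i, 0 ≤ Real.log (1 / w i) := fun i =>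
    Real.log_nonneg (by rw [le_div_iff₀ (hw i)]; linarith [hw1 i])
  have hpint : ∀ i l, Integrable (p i l) P := by
    intro i l
    have hi := (hY.sub (hf i)).integrable_sq
    have hl := (hY.sub (hf l)).integrable_sq
    have hj := (hY.sub (hf j)).integrable_sq
    have hij := ((hf i).sub (hf j)).integrable_sq
    have hlj := ((hf l).sub (hf j)).integrable_sq
    have hm : Integrable (fun x => (f i (X x) - f j (X x)) * (f l (X x) - f j (X x))) P :=
      ((hf i).sub (hf j)).integrable_mul ((hf l).sub (hf j))
    exact ((((hi.add hl).div_const 2).sub hj).sub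
      (((hij.add hlj).const_mul (1 - ν)).div_const 2)).add (hm.const_mul _)
  -- the empirical side
  have hemp : 1 / (n : ℝ) * ∑ m, ∑ i, ∑ l, θ i * θ l * p i l (z m)
      + β / n * (∑ i, θ i * Real.log (1 / w i)) - β / n * Real.log (1 / w j) ≤ 0 := by
    have e : ∀ m, ∑ i, ∑ l, θ i * θ l * p i l (z m) =
        modLoss ν Y X f θ g (z m) - modLoss ν Y X f (Pi.single j 1) g (z m)
        + 5 * μ * (ensemble f θ (X (z m)) - f j (X (z m))) ^ 2 :=
      fun m => (modLoss_sub_eq ν (5 * μ) Y X f hθ.2 g (z m) j).symm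
    simp only [e, Finset.sum_add_distrib, Finset.sum_sub_distrib, ← Finset.mul_sum]
    have hs : ∑ i, (Pi.single j 1 : Fin M → ℝ) i * Real.log (1 / w i) = Real.log (1 / w j) := by
      simp [Pi.single_apply]
    unfold qObjective at hQ
    rw [hs] at hQ
    have h0 : 0 ≤ 1 / (n : ℝ) * ∑ i, (ensemble f θ (X (z i)) - f j (X (z i))) ^ 2 := by
      positivity
    -- This is where the factor `1/60` in the bound on `μ` is used.
    have h1 := mul_le_mul_of_nonneg_right (by linarith : 5 * μ ≤ (1 - ν) / 12) h0
    linarith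
  -- the population side
  have hpop : (∫ z, (modLoss ν Y X f θ g z - modLoss ν Y X f (Pi.single j 1) g z) ∂P)
      + 5 * μ * Dθ = ∑ i, ∑ l, θ i * θ l * ∫ x, p i l x ∂P := by
    simp only [← integral_const_mul]
    have hi : ∀ i l, Integrable (fun x => θ i * θ l * p i l x) P :=
      fun i l => (hpint i l).const_mul _
    simp only [← integral_finsetSum Finset.univ fun l _ => hi _ l]
    rw [← integral_finsetSum Finset.univ fun i _ => integrable_finsetSum _ fun l _ => hi i l]
    simp only [hp, ← modLoss_sub_eq ν (5 * μ) Y X f hθ.2 g _ j]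
    have hm : Integrable
        (fun z => modLoss ν Y X f θ g z - modLoss ν Y X f (Pi.single j 1) g z) P :=
      (integrable_modLoss ν hf hY θ).sub (integrable_modLoss ν hf hY _)
    have hv : Integrable (fun z => 5 * μ * (ensemble f θ (X z) - f j (X z)) ^ 2) P :=
      ((memLp_ensemble hf θ).sub (hf j)).integrable_sq.const_mul _
    rw [integral_add hm hv, integral_const_mul]
  have hsum : (∑ i, ∑ l, θ i * θ l * ∫ x, p i l x ∂P)
      - 1 / (n : ℝ) * ∑ m, ∑ i, ∑ l, θ i * θ l * p i l (z m)
      ≤ 9 / 2 * μ * (∑ i, θ i * D i)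
        + κ / n * (2 * (∑ i, θ i * Real.log (1 / w i)) + L) := by
    have e1 : (∑ i, ∑ l, θ i * θ l * ∫ x, p i l x ∂P)
        - 1 / (n : ℝ) * ∑ m, ∑ i, ∑ l, θ i * θ l * p i l (z m)
        = ∑ i, ∑ l, θ i * θ l * ((∫ x, p i l x ∂P) - 1 / (n : ℝ) * ∑ m, p i l (z m)) := by
      have e0 : ∑ m, ∑ i, ∑ l, θ i * θ l * p i l (z m)
          = ∑ i, ∑ l, θ i * θ l * ∑ m, p i l (z m) := by
        rw [Finset.sum_comm]
        refine Finset.sum_congr rfl fun i _ => ?_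
        rw [Finset.sum_comm]
        simp only [Finset.mul_sum]
      rw [e0]
      simp only [mul_sub, Finset.sum_sub_distrib, Finset.mul_sum, mul_left_comm]
    have e2 : ∑ i, ∑ l, θ i * θ l * (9 / 4 * μ * (D i + D l)
        + κ / n * (Real.log (1 / w i) + Real.log (1 / w l) + L))
        = 9 / 2 * μ * (∑ i, θ i * D i)
        + κ / n * (2 * (∑ i, θ i * Real.log (1 / w i)) + L) := by
      have e3 : ∀ i l, θ i * θ l * (9 / 4 * μ * (D i + D l)
        + κ / n * (Real.log (1 / w i) + Real.log (1 / w l) + L)) =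
        9 / 4 * μ * (θ i * θ l * (D i + D l))
        + κ / n * (θ i * θ l * (Real.log (1 / w i) + Real.log (1 / w l)))
        + κ / n * L * (θ i * θ l) := fun i l => by ring
      simp only [e3, Finset.sum_add_distrib, ← Finset.mul_sum, sum_sum_add hθ.2, hθ.2, mul_one]
      ring
    rw [e1, ← e2]
    exact Finset.sum_le_sum fun i _ => Finset.sum_le_sum fun l _ =>
      mul_le_mul_of_nonneg_left (hconc i l) (mul_nonneg (hθ.1 i) (hθ.1 l))
  have hrisk := risk_sub_eq ν hf hY₀ hθ.2 j
  have hV := sum_mul_sq_sub_ge hf hθ j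
  have hDθ0 : 0 ≤ Dθ := integral_nonneg fun _ => sq_nonneg _
  have hsq : l2Dist P X f θ (Pi.single j 1) ^ 2 = Dθ := by
    simp only [l2Dist, ensemble_single]
    exact Real.sq_sqrt hDθ0
  have hyoung := mul_rpow_le_sq_add (x := l2Dist P X f θ (Pi.single j 1)) hμ hE
    (Real.sqrt_nonneg _) hγ₀ hγ₁
  rw [hsq] at hyoung
  have hK : 0 ≤ ∑ i, θ i * Real.log (1 / w i) :=
    Finset.sum_nonneg fun i _ => mul_nonneg (hθ.1 i) (hlogs i)
  have hn0 : (0 : ℝ) ≤ 1 / n := by positivity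
  -- The gain `5μ Dθ` splits as `(9/2)μ Dθ`, which centres the variance term into a dispersion
  -- dominated by the `ν`-term, and `(μ/2) Dθ`, which pays for Young's inequality.
  have h1 : 9 / 2 * μ * ((∑ i, θ i * D i) - Dθ) ≤ ν * ((∑ i, θ i * D i) - Dθ) :=
    mul_le_mul_of_nonneg_right hνμ (sub_nonneg.2 hV)
  have h2 : 2 * κ * (1 / n * ∑ i, θ i * Real.log (1 / w i))
      ≤ β * (1 / n * ∑ i, θ i * Real.log (1 / w i)) :=
    mul_le_mul_of_nonneg_right hκ (mul_nonneg hn0 hK)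
  -- The argument leaves coefficient `1` on this term; the stated `3/2` is slack.
  have h3 : 0 ≤ β * (1 / n) * Real.log (1 / w j) :=
    mul_nonneg (mul_nonneg hβ hn0) (hlogs j)
  have e4 : 3 * β / (2 * (n : ℝ)) * Real.log (1 / w j)
      = 3 / 2 * (β * (1 / n) * Real.log (1 / w j)) := by ring
  have e5 : β / n * Real.log (1 / w j) = β * (1 / n) * Real.log (1 / w j) := by ring
  have e6 : β / n * (∑ i, θ i * Real.log (1 / w i))
      = β * (1 / n * ∑ i, θ i * Real.log (1 / w i)) := by ring
  have e7 : κ / n * (2 * (∑ i, θ i * Real.log (1 / w i)) + L)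
      = 2 * κ * (1 / n * ∑ i, θ i * Real.log (1 / w i)) + κ / n * L := by ring
  rw [e5, e6] at hemp
  rw [e7] at hsum
  rw [e4]
  linarith

/-- The temperature condition in the form in which it is used. -/
lemma two_mul_le_of_max_le {U μ ν β : ℝ} (hU : 0 ≤ U) (hμ : 0 < μ) (hν : 0 ≤ ν)
    (hβ : max (64 * U ^ 2 * (1 - ν) ^ 2 / μ) (16 * ν * U ^ 2 * (ν + 8 * μ * U) / μ) ≤ β) :
    2 * (32 * U ^ 2 / (9 * μ)) ≤ β := by
  have e : 2 * (32 * U ^ 2 / (9 * μ)) = 64 / 9 * U ^ 2 / μ := by field_simp; ring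
  rw [e]
  -- At `ν = 2/3`, both `64 (1 - ν)²` and `16 ν²` equal the required `64/9`.
  rcases le_total ν (2 / 3) with h | h
  · refine le_trans ?_ ((le_max_left _ _).trans hβ)
    refine div_le_div_of_nonneg_right ?_ hμ.le
    nlinarith [sq_nonneg U, mul_nonneg (sq_nonneg U) (by nlinarith : 0 ≤ (1 - ν) ^ 2 - 1 / 9)]
  · refine le_trans ?_ ((le_max_right _ _).trans hβ)
    refine div_le_div_of_nonneg_right ?_ hμ.le
    have h1 : 0 ≤ 128 * (ν * U ^ 2 * (μ * U)) := by positivity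
    nlinarith [mul_nonneg (sq_nonneg U) (by nlinarith : 0 ≤ ν ^ 2 - 4 / 9)]

end QAgg

/-! ### Union bound over pairs and conclusion -/

/-- `P` is the law of one observation `Z`, the sample `Z 0, …, Z (n-1)` is i.i.d. from `P`, the
models `f j` and the nuisance estimate `ghat` are fixed (they come from separate data). The output
`θk` is any selection of outputs of GMA-0₊, measurable or not, and the conclusion bounds the (outer)
probability of the failure event. -/
theorem mainTheorem9 :
    ∃ C : ℝ, 0 < C ∧
      ∀ {Ω 𝒵 𝒳 G : Type*} [MeasurableSpace Ω] [MeasurableSpace 𝒵] [MeasurableSpace 𝒳]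
        (Pr : Measure Ω) [IsProbabilityMeasure Pr] (P : Measure 𝒵) [IsProbabilityMeasure P]
        (M n : ℕ) (_hM : 1 ≤ M) (_hn : 1 ≤ n)
        (Z : Fin n → Ω → 𝒵) (_hZ : ∀ i, Measurable (Z i)) (_hlaw : ∀ i, Measure.map (Z i) Pr = P)
        (_hindep : iIndepFun Z Pr)
        (X : 𝒵 → 𝒳) (_hX : Measurable X)
        (f : Fin M → 𝒳 → ℝ) (_hf : ∀ j, Measurable (f j))
        (Y : G → 𝒵 → ℝ) (g₀ ghat : G)
        (_hY₀ : MemLp (Y g₀) 2 P) (_hYhat : Measurable (Y ghat))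
        (U : ℝ) (_hYU : ∀ᵐ z ∂P, |Y ghat z| ≤ U) (_hfU : ∀ j, ∀ᵐ z ∂P, |f j (X z)| ≤ U)
        (w : Fin M → ℝ) (_hw : ∀ j, 0 < w j) (_hw_sum : ∑ j, w j = 1)
        (ν μ β : ℝ) (_hν : 1 / 2 ≤ ν) (_hμ : 0 < μ) (_hμν : μ ≤ 1 / 60 * (1 - ν))
        (_hβ : max (64 * U ^ 2 * (1 - ν) ^ 2 / μ) (16 * ν * U ^ 2 * (ν + 8 * μ * U) / μ) ≤ β)
        (γ : ℝ) (_hγ₀ : 0 ≤ γ) (_hγ₁ : γ ≤ 1)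
        (Err : G → ℝ) (_hErr₀ : 0 ≤ Err ghat)
        (_hErr : ∀ θ ∈ stdSimplex ℝ (Fin M), ∀ θ' ∈ stdSimplex ℝ (Fin M),
          (∫ z, (QAgg.modLoss ν Y X f θ g₀ z - QAgg.modLoss ν Y X f θ' g₀ z) ∂P)
            - (∫ z, (QAgg.modLoss ν Y X f θ ghat z - QAgg.modLoss ν Y X f θ' ghat z) ∂P)
            ≤ Err ghat * QAgg.l2Dist P X f θ θ' ^ γ)
        (k : ℕ) (_hk : 2 ≤ k)
        (θk : Ω → Fin M → ℝ)
        (_hθk : ∀ ω,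
          QAgg.IsGMAOutput (QAgg.qObjective ν β w Y X f ghat (fun i => Z i ω)) k (θk ω))
        (δ : ℝ) (_hδ₀ : 0 < δ) (_hδ₁ : δ < 1),
        Pr {ω | ¬ (QAgg.risk P Y X f (θk ω) g₀ ≤
            (⨅ j : Fin M, (QAgg.risk P Y X f (Pi.single j 1) g₀
              + 3 * β / (2 * (n : ℝ)) * Real.log (1 / w j)))
            + C * (Real.log (1 / δ) * (1 / μ * U ^ 2) / (n : ℝ))
            + (1 / μ) ^ (γ / (2 - γ)) * Err ghat ^ (2 / (2 - γ)))}
          ≤ ENNReal.ofReal δ := by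
  refine ⟨32 / 9, by norm_num, ?_⟩
  intro Ω 𝒵 𝒳 G _ _ _ Pr _ P _ M n hM hn Z hZ hlaw hindep X hX f hf Y g₀ ghat hY₀ hYhat U hYU hfU
    w hw hw_sum ν μ β hν hμ hμν hβ γ hγ₀ hγ₁ Err hErr₀ hErr k hk θk hθk δ hδ₀ hδ₁
  have : NeZero M := ⟨by omega⟩
  have hU : 0 ≤ U := by
    obtain ⟨z, hz⟩ := hYU.exists
    exact (abs_nonneg _).trans hz
  have hfU' : ∀ᵐ z ∂P, ∀ j, |f j (X z)| ≤ U := ae_all_iff.2 hfU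
  have hfL : ∀ j, MemLp (fun z => f j (X z)) 2 P := fun j =>
    MemLp.of_bound ((hf j).comp hX).aestronglyMeasurable U (hfU j)
  have hYL : MemLp (Y ghat) 2 P := MemLp.of_bound hYhat.aestronglyMeasurable U hYU
  have hw1 : ∀ j, w j ≤ 1 := fun j => by
    rw [← hw_sum]
    exact Finset.single_le_sum (fun i _ => (hw i).le) (Finset.mem_univ j)
  set κ := 32 * U ^ 2 / (9 * μ) with hκ
  have hκ0 : 0 ≤ κ := by positivity
  have hκβ : 2 * κ ≤ β := QAgg.two_mul_le_of_max_le hU hμ (by linarith) hβ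
  -- The oracle vertex is deterministic, so the union bound runs over `(i, l)` only.
  obtain ⟨j, hj⟩ := exists_eq_ciInf_of_finite (f := fun j : Fin M =>
    QAgg.risk P Y X f (Pi.single j 1) g₀ + 3 * β / (2 * (n : ℝ)) * Real.log (1 / w j))
  rw [← hj]
  set p : Fin M → Fin M → 𝒵 → ℝ := fun i l x =>
    QAgg.pairing ν (1 - ν + 5 * μ) (Y ghat x) (fun i => f i (X x)) j i l with hp
  set D : Fin M → ℝ := fun i => ∫ x, (f i (X x) - f j (X x)) ^ 2 ∂P with hD
  -- The levels `w i * w l * δ` sum to `δ`. These events do not involve `θk`, so its measurability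
  -- plays no role.
  set bad : Fin M → Fin M → Set Ω := fun i l =>
    {ω | 9 / 4 * μ * (D i + D l) + κ / n * Real.log (1 / (w i * w l * δ))
        < (∫ x, p i l x ∂P) - 1 / (n : ℝ) * ∑ m, p i l (Z m ω)} with hbad
  have hbad_le : ∀ i l, Pr (bad i l) ≤ ENNReal.ofReal (w i * w l * δ) := by
    intro i l
    have hd : ∀ i, Integrable (fun z => (f i (X z) - f j (X z)) ^ 2) P :=
      fun i => ((hfL i).sub (hfL j)).integrable_sq
    have hfm : ∀ i, Measurable fun z => f i (X z) := fun i => (hf i).comp hX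
    have hpm : Measurable (p i l) := by
      simp only [hp, QAgg.pairing]
      fun_prop
    have hpB : ∀ᵐ z ∂P, |p i l z| ≤ 8 * U ^ 2 := by
      filter_upwards [hYU, hfU'] with z h1 h2
      exact QAgg.abs_pairing_le_sq h1 h2 (by linarith) (by linarith) (by linarith) j i l
    have hint : Integrable (fun z => p i l z ^ 2) P := by
      refine Integrable.of_bound (hpm.pow_const 2).aestronglyMeasurable ((8 * U ^ 2) ^ 2) ?_
      filter_upwards [hpB] with z hz
      rw [Real.norm_eq_abs, abs_pow]
      exact pow_le_pow_left₀ (abs_nonneg _) hz 2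
    refine QAgg.measure_mean_deviation_le hn hZ hlaw hindep hpm hU hμ (by linarith)
      (add_nonneg (integral_nonneg fun _ => sq_nonneg _) (integral_nonneg fun _ => sq_nonneg _))
      hpB ?_ (mul_pos (mul_pos (hw i) (hw l)) hδ₀)
    rw [← integral_add (hd i) (hd l), ← integral_const_mul]
    refine integral_mono_ae hint (((hd i).add (hd l)).const_mul _) ?_
    filter_upwards [hYU, hfU'] with z h1 h2
    exact QAgg.pairing_sq_le h1 h2 (by linarith) (by linarith) (by linarith) j i l
  have hunion : Pr (⋃ i, ⋃ l, bad i l) ≤ ENNReal.ofReal δ := by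
    calc Pr (⋃ i, ⋃ l, bad i l) ≤ ∑ i, Pr (⋃ l, bad i l) := measure_iUnion_fintype_le _ _
      _ ≤ ∑ i, ∑ l, ENNReal.ofReal (w i * w l * δ) := Finset.sum_le_sum fun i _ =>
          (measure_iUnion_fintype_le _ _).trans (Finset.sum_le_sum fun l _ => hbad_le i l)
      _ = ENNReal.ofReal δ := by
          have h0 : ∀ i l, 0 ≤ w i * w l * δ := fun i l =>
            (mul_pos (mul_pos (hw i) (hw l)) hδ₀).le
          simp only [← ENNReal.ofReal_sum_of_nonneg fun l _ => h0 _ l]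
          rw [← ENNReal.ofReal_sum_of_nonneg fun i _ => Finset.sum_nonneg fun l _ => h0 i l]
          simp only [← Finset.sum_mul, ← Finset.mul_sum, hw_sum, mul_one, one_mul]
  refine le_trans (measure_mono fun ω hω => ?_) hunion
  by_contra hgood
  simp only [Set.mem_iUnion, not_exists, hbad, Set.mem_ofPred_eq, not_lt] at hgood
  refine hω ?_
  have hθ := (hθk ω).mem_stdSimplex (by omega)
  have key := QAgg.risk_le_of_concentration (L := Real.log (1 / δ)) hfL hY₀ hYL hw hw1 hμ hμν
    (by linarith) hκβ (by linarith) hγ₀ hγ₁ hErr₀ hθ j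
    (hErr _ hθ _ (single_mem_stdSimplex ℝ j))
    ((hθk ω).qObjective_add_le (by linarith) hk j) (fun i l => by
      have h1 := hgood i l
      have h2 : Real.log (1 / (w i * w l * δ))
          = Real.log (1 / w i) + Real.log (1 / w l) + Real.log (1 / δ) := by
        simp only [one_div, Real.log_inv]
        rw [Real.log_mul (mul_pos (hw i) (hw l)).ne' hδ₀.ne',
          Real.log_mul (hw i).ne' (hw l).ne']
        ring
      rw [h2] at h1
      linarith)
  have e : κ / n * Real.log (1 / δ)
      = 32 / 9 * (Real.log (1 / δ) * (1 / μ * U ^ 2) / (n : ℝ)) := by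
    rw [hκ]
    field_simp
  rw [e] at key
  exact key
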